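/- Let $\mathcal H$ be a complex Hilbert space, $\mathcal D\subseteq\mathcal H$ a dense subspace, and $\mathcal M_0$ a norm-closed $*$-subalgebra of $\mathcal B(\mathcal H)$ containing the identity $I$ of $\mathcal H$; let $\mathcal M_0''$ be its bicommutant, and suppose that $\mathcal M_0''\mathcal D\subseteq\mathcal D$. Let $\mathcal L^\dagger(\mathcal D,\mathcal H)$ be the space of linear operators $X:\mathcal D\to\mathcal H$ whose Hilbert space adjoint $X^*$ has a domain containing $\mathcal D$, put $X^\dagger:=X^*\lceil\mathcal D$, and let $\tau_{s^*}$ be the locally convex topology on $\mathcal L^\dagger(\mathcal D,\mathcal H)$ defined by the seminorms $X\mapsto\|X\xi\|+\|X^\dagger\xi\|$, $\xi\in\mathcal D$. Each $X\in\mathcal M_0''$ is regarded as the element $X\lceil\mathcal D$ of $\mathcal L^\dagger(\mathcal D,\mathcal H)$; since $\mathcal L^\dagger(\mathcal D,\mathcal H)$ is complete for $\tau_{s^*}$, the completion $\widetilde{\mathcal M_0''}[\tau_{s^*}]$ is the $\tau_{s^*}$-closure of $\mathcal M_0''$ in it. For $T\in\widetilde{\mathcal M_0''}[\tau_{s^*}]$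 and $B\in\mathcal M_0''$ the products $TB$ and $BT$ are the operators $\xi\mapsto T(B\xi)$ and $\xi\mapsto B(T\xi)$ on $\mathcal D$. Let $A\in\widetilde{\mathcal M_0''}[\tau_{s^*}]$. Then the following statements are equivalent: (i) $A$ is commutatively quasi-positive, i.e. there is a net $(X_\alpha)$ of positive elements of $\mathcal M_0''$ with $X_\alpha X_\beta=X_\beta X_\alpha$ for all $\alpha,\beta$ that converges to $A$ with respect to $\tau_{s^*}$; (ii) $I+A$ is invertible with $(I+A)^{-1}\in\mathcal U(\mathcal M_0'')_+$, i.e. there is a positive $B\in\mathcal M_0''$ with $\|B\|\le 1$ and $(I+A)B=I=B(I+A)$ on $\mathcal D$; (iii) the closure $\overline A$ of $A$ is a positive self-adjoint operator in $\mathcal H$. -/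

import Mathlib

open Filter Topology

universe u

namespace UnboundedOp

noncomputable section

variable {H : Type u} [NormedAddCommGroup H] [InnerProductSpace ℂ H] [CompleteSpace H]

/-- A linear map `X : D → H`, viewed as an (in general unbounded) operator in `H` with domain `D`. -/
def toPMap {D : Submodule ℂ H} (X : D →ₗ[ℂ] H) : H →ₗ.[ℂ] H := ⟨D, X⟩

/-- The space `L†(D, H)` of all linear operators `X : D → H` such that the domain of the Hilbert
space adjoint `X*` contains `D`. -/
def LDagger (D : Submodule ℂ H) : Submodule ℂ (D →ₗ[ℂ] H) where
  carrier := {X | D ≤ (toPMap X).adjoint.domain}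
  zero_mem' := fun y _ => by
    rw [LinearPMap.mem_adjoint_domain_iff]
    have h : ((innerₛₗ ℂ y).comp (toPMap (0 : D →ₗ[ℂ] H)).toFun) = 0 := by
      ext x; exact inner_zero_right _
    rw [h]
    exact continuous_zero
  add_mem' := fun {S T} hS hT y hy => by
    have h1 := (LinearPMap.mem_adjoint_domain_iff _ _).1 (hS hy)
    have h2 := (LinearPMap.mem_adjoint_domain_iff _ _).1 (hT hy)
    rw [LinearPMap.mem_adjoint_domain_iff]
    have h : ((innerₛₗ ℂ y).comp (toPMap (S + T)).toFun : D → ℂ) =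
        fun x => (innerₛₗ ℂ y).comp (toPMap S).toFun x + (innerₛₗ ℂ y).comp (toPMap T).toFun x := by
      funext x; exact inner_add_right _ _ _
    exact h ▸ h1.add h2
  smul_mem' := fun c S hS y hy => by
    have h1 := (LinearPMap.mem_adjoint_domain_iff _ _).1 (hS hy)
    rw [LinearPMap.mem_adjoint_domain_iff]
    have h : ((innerₛₗ ℂ y).comp (toPMap (c • S)).toFun : D → ℂ) =
        fun x => c • (innerₛₗ ℂ y).comp (toPMap S).toFun x := by
      funext x; exact inner_smul_right _ _ _
    exact h ▸ h1.const_smul c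

/-- The involution `X† = X* ⌈ D` of `L†(D, H)`, as a map `D → H`. -/
def dagger {D : Submodule ℂ H} (X : LDagger D) (η : D) : H :=
  (toPMap X.1).adjoint ⟨η, X.2 η.2⟩

/-- The (uniform structure of the) strong* topology `τ_{s*}` on `L†(D, H)`, i.e. of the locally
convex topology given by the seminorms `X ↦ ‖X ξ‖ + ‖X† ξ‖` with `ξ ∈ D`: pointwise convergence
on `D` in norm of `X` and of `X†`. -/
instance strongStar (D : Submodule ℂ H) : UniformSpace (LDagger D) :=
  UniformSpace.comap (fun X => ((fun ξ : D => (X.1 ξ : H)), (fun ξ : D => dagger X ξ)))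
    (inferInstance : UniformSpace ((D → H) × (D → H)))

variable {D : Submodule ℂ H}

theorem inner_dagger (hD : Dense (D : Set H)) (X : LDagger D) (η ξ : D) :
    inner ℂ (dagger X η) (ξ : H) = inner ℂ (η : H) (X.1 ξ) :=
  LinearPMap.adjoint_isFormalAdjoint (T := toPMap X.1) hD ⟨η, X.2 η.2⟩ ξ

theorem mem_LDagger_of_formal (X : D →ₗ[ℂ] H) (Y : D → H)
    (h : ∀ η ξ : D, inner ℂ (Y η) (ξ : H) = inner ℂ (η : H) (X ξ)) : X ∈ LDagger D :=
  fun y hy => LinearPMap.mem_adjoint_domain_of_exists _ ⟨Y ⟨y, hy⟩, fun x => h ⟨y, hy⟩ x⟩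

theorem dagger_eq (hD : Dense (D : Set H)) (X : LDagger D) (η : D) (y : H)
    (h : ∀ ξ : D, inner ℂ y (ξ : H) = inner ℂ (η : H) (X.1 ξ)) : dagger X η = y :=
  LinearPMap.adjoint_apply_eq (T := toPMap X.1) hD ⟨η, X.2 η.2⟩ h

theorem tendsto_strongStar {ι : Type*} {l : Filter ι} {X : ι → LDagger D} {A : LDagger D} :
    Tendsto X l (𝓝 A) ↔ (∀ ξ : D, Tendsto (fun i => (X i).1 ξ) l (𝓝 (A.1 ξ))) ∧
      ∀ ξ : D, Tendsto (fun i => dagger (X i) ξ) l (𝓝 (dagger A ξ)) := by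
  have h : IsInducing (fun X : LDagger D =>
    ((fun ξ : D => (X.1 ξ : H)), (fun ξ : D => dagger X ξ))) := ⟨rfl⟩
  rw [h.tendsto_nhds_iff, Prod.tendsto_iff, tendsto_pi_nhds, tendsto_pi_nhds]
  rfl

/-- `τ_{s*}` is the topology of the seminorms `X ↦ ‖X ξ‖ + ‖X† ξ‖`. -/
theorem tendsto_strongStar_iff_seminorm (hD : Dense (D : Set H)) {ι : Type*} {l : Filter ι}
    {X : ι → LDagger D} {A : LDagger D} :
    Tendsto X l (𝓝 A) ↔
      ∀ ξ : D, Tendsto (fun i => ‖(X i - A).1 ξ‖ + ‖dagger (X i - A) ξ‖) l (𝓝 0) := by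
  have hd : ∀ i ξ, dagger (X i - A) ξ = dagger (X i) ξ - dagger A ξ := fun i ξ =>
    dagger_eq hD _ _ _ fun η => by
      simp [inner_dagger hD]
  rw [tendsto_strongStar]
  simp only [hd, Submodule.coe_sub, LinearMap.sub_apply]
  constructor
  · rintro ⟨h1, h2⟩ ξ
    simpa using (tendsto_iff_norm_sub_tendsto_zero.1 (h1 ξ)).add
      (tendsto_iff_norm_sub_tendsto_zero.1 (h2 ξ))
  · intro h
    exact ⟨fun ξ => tendsto_iff_norm_sub_tendsto_zero.2
        (squeeze_zero (fun _ => norm_nonneg _) (fun _ => le_add_of_nonneg_right (norm_nonneg _))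
          (h ξ)),
      fun ξ => tendsto_iff_norm_sub_tendsto_zero.2
        (squeeze_zero (fun _ => norm_nonneg _) (fun _ => le_add_of_nonneg_left (norm_nonneg _))
          (h ξ))⟩

instance : T2Space (LDagger D) := by
  have h : IsInducing (fun X : LDagger D =>
    ((fun ξ : D => (X.1 ξ : H)), (fun ξ : D => dagger X ξ))) := ⟨rfl⟩
  refine T2Space.of_injective_continuous (fun X Y hXY => ?_) h.continuous
  exact Subtype.ext (LinearMap.ext fun ξ => congrFun (congrArg Prod.fst hXY) ξ)

/-- `L†(D, H)` is complete for `τ_{s*}`, so that the completion of a subspace is its closure. -/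
theorem completeSpace_LDagger (hD : Dense (D : Set H)) : CompleteSpace (LDagger D) := by
  have hi : IsUniformInducing (fun X : LDagger D =>
    ((fun ξ : D => (X.1 ξ : H)), (fun ξ : D => dagger X ξ))) := ⟨rfl⟩
  rw [completeSpace_iff_isComplete_range hi]
  apply IsClosed.isComplete
  have hr : Set.range (fun X : LDagger D =>
      ((fun ξ : D => (X.1 ξ : H)), (fun ξ : D => dagger X ξ))) =
      {p | (∀ ξ η : D, p.1 (ξ + η) = p.1 ξ + p.1 η) ∧ (∀ (c : ℂ) (ξ : D), p.1 (c • ξ) = c • p.1 ξ) ∧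
        ∀ η ξ : D, inner ℂ (p.2 η) (ξ : H) = inner ℂ (η : H) (p.1 ξ)} := by
    ext ⟨f, g⟩
    constructor
    · rintro ⟨X, hX⟩
      obtain ⟨rfl, rfl⟩ := Prod.mk.inj hX
      exact ⟨map_add X.1, map_smul X.1, inner_dagger hD X⟩
    · rintro ⟨h1, h2, h3⟩
      let X : LDagger D := ⟨⟨⟨f, h1⟩, h2⟩, mem_LDagger_of_formal _ g h3⟩
      exact ⟨X, Prod.ext rfl (funext fun η => dagger_eq hD X η _ (h3 η))⟩
  rw [hr]
  simp only [Set.ofPred_and, Set.ofPred_forall]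
  refine IsClosed.inter ?_ (IsClosed.inter ?_ ?_)
  · exact isClosed_iInter fun ξ => isClosed_iInter fun η =>
      isClosed_eq (by fun_prop) (by fun_prop)
  · exact isClosed_iInter fun c => isClosed_iInter fun ξ =>
      isClosed_eq (by fun_prop) (by fun_prop)
  · exact isClosed_iInter fun η => isClosed_iInter fun ξ =>
      isClosed_eq (by fun_prop) (by fun_prop)

/-- The restriction `X ⌈ D` of a bounded operator, as an element of `L†(D, H)`. -/
def restrict (D : Submodule ℂ H) (X : H →L[ℂ] H) : LDagger D :=
  ⟨X.toLinearMap.comp D.subtype, mem_LDagger_of_formal _ (fun η => star X (η : H)) fun _ _ =>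
    X.adjoint_inner_left _ _⟩

/-- `S D ⊆ D`. -/
def LeavesInvariant (S : Set (H →L[ℂ] H)) (D : Submodule ℂ H) : Prop :=
  ∀ X ∈ S, ∀ ξ ∈ D, X ξ ∈ D

/-- The bicommutant of a *-algebra of bounded operators, a von Neumann algebra. -/
def bicommutant (M₀ : StarSubalgebra ℂ (H →L[ℂ] H)) : VonNeumannAlgebra H where
  toStarSubalgebra := StarSubalgebra.centralizer ℂ
    (StarSubalgebra.centralizer ℂ (M₀ : Set (H →L[ℂ] H)) : Set (H →L[ℂ] H))
  centralizer_centralizer' := by simp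

theorem coe_bicommutant (M₀ : StarSubalgebra ℂ (H →L[ℂ] H)) :
    (bicommutant M₀ : Set (H →L[ℂ] H)) =
      Set.centralizer (Set.centralizer (M₀ : Set (H →L[ℂ] H))) := by
  have h : (StarSubalgebra.centralizer ℂ (M₀ : Set (H →L[ℂ] H)) : Set (H →L[ℂ] H)) =
      Set.centralizer (M₀ : Set (H →L[ℂ] H)) := by
    simp
  have h2 : ((bicommutant M₀).toStarSubalgebra : Set (H →L[ℂ] H)) =
      Set.centralizer (Set.centralizer (M₀ : Set (H →L[ℂ] H))) := by
    rw [bicommutant, StarSubalgebra.coe_centralizer_centralizer]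
    simp
  exact h2

/-- The completion of `M[τ_{s*}]`, realized as the `τ_{s*}`-closure of `M ⌈ D` in the complete
space `L†(D, H)`. -/
def completion (M : VonNeumannAlgebra H) (D : Submodule ℂ H) : Set (LDagger D) :=
  closure (restrict D '' (M : Set (H →L[ℂ] H)))

/-- `A` is commutatively quasi-positive: it is the `τ_{s*}`-limit of a commuting net in the
positive cone of `M`. -/
def IsCommQuasiPositive (M : VonNeumannAlgebra H) (A : LDagger D) : Prop :=
  ∃ (ι : Type u) (_ : Preorder ι) (_ : IsDirectedOrder ι) (_ : Nonempty ι) (X : ι → H →L[ℂ] H),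
    (∀ i, X i ∈ M ∧ (X i).IsPositive) ∧ (∀ i j, X i * X j = X j * X i) ∧
      Tendsto (fun i => restrict D (X i)) atTop (𝓝 A)

/-- The positive part of the closed unit ball of `M`. -/
def positiveUnitBall (M : VonNeumannAlgebra H) : Set (H →L[ℂ] H) :=
  {B | B ∈ M ∧ B.IsPositive ∧ ‖B‖ ≤ 1}

/-- The product `T B` of `T ∈ L†(D, H)` with a bounded operator `B` leaving `D` invariant. -/
def mulBounded (hD : Dense (D : Set H)) (T : LDagger D) (B : H →L[ℂ] H)
    (hB : ∀ ξ ∈ D, B ξ ∈ D) : LDagger D :=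
  ⟨T.1.comp (B.toLinearMap.restrict hB),
    mem_LDagger_of_formal _ (fun η => star B (dagger T η)) fun η ξ => by
      rw [ContinuousLinearMap.star_eq_adjoint, ContinuousLinearMap.adjoint_inner_left]
      exact inner_dagger hD T η ⟨B ξ, hB ξ ξ.2⟩⟩

/-- The product `B T` of `T ∈ L†(D, H)` with a bounded operator `B` whose adjoint leaves `D`
invariant. -/
def boundedMul (hD : Dense (D : Set H)) (B : H →L[ℂ] H) (hB : ∀ ξ ∈ D, star B ξ ∈ D)
    (T : LDagger D) : LDagger D :=
  ⟨B.toLinearMap.comp T.1,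
    mem_LDagger_of_formal _ (fun η => dagger T ⟨star B (η : H), hB η η.2⟩) fun η ξ => by
      rw [inner_dagger hD T ⟨star B (η : H), hB η η.2⟩ ξ]
      exact B.adjoint_inner_left _ _⟩

/-- `T B = τ_{s*}-lim X_i B` whenever `T = τ_{s*}-lim X_i`. -/
theorem tendsto_mulBounded (hD : Dense (D : Set H)) {ι : Type*} {l : Filter ι}
    {X : ι → H →L[ℂ] H} {T : LDagger D} (h : Tendsto (fun i => restrict D (X i)) l (𝓝 T))
    (B : H →L[ℂ] H) (hB : ∀ ξ ∈ D, B ξ ∈ D) :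
    Tendsto (fun i => restrict D (X i * B)) l (𝓝 (mulBounded hD T B hB)) := by
  rw [tendsto_strongStar] at h ⊢
  have hr : ∀ (Y : H →L[ℂ] H) (η : D), dagger (restrict D Y) η = star Y (η : H) := fun Y η =>
    dagger_eq hD _ _ _ fun ξ => Y.adjoint_inner_left _ _
  have hm : ∀ η : D, dagger (mulBounded hD T B hB) η = star B (dagger T η) := fun η =>
    dagger_eq hD _ _ _ fun ξ => by
      rw [ContinuousLinearMap.star_eq_adjoint, ContinuousLinearMap.adjoint_inner_left]
      exact inner_dagger hD T η ⟨B ξ, hB ξ ξ.2⟩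
  refine ⟨fun ξ => h.1 ⟨B ξ, hB ξ ξ.2⟩, fun η => ?_⟩
  have := ((star B).continuous.tendsto _).comp (h.2 η)
  simpa [hr, hm, Function.comp_def, star_mul] using this

/-- `B T = τ_{s*}-lim B X_i` whenever `T = τ_{s*}-lim X_i`. -/
theorem tendsto_boundedMul (hD : Dense (D : Set H)) {ι : Type*} {l : Filter ι}
    {X : ι → H →L[ℂ] H} {T : LDagger D} (h : Tendsto (fun i => restrict D (X i)) l (𝓝 T))
    (B : H →L[ℂ] H) (hB : ∀ ξ ∈ D, star B ξ ∈ D) :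
    Tendsto (fun i => restrict D (B * X i)) l (𝓝 (boundedMul hD B hB T)) := by
  rw [tendsto_strongStar] at h ⊢
  have hr : ∀ (Y : H →L[ℂ] H) (η : D), dagger (restrict D Y) η = star Y (η : H) := fun Y η =>
    dagger_eq hD _ _ _ fun ξ => Y.adjoint_inner_left _ _
  have hm : ∀ η : D, dagger (boundedMul hD B hB T) η = dagger T ⟨star B (η : H), hB η η.2⟩ :=
    fun η => dagger_eq hD _ _ _ fun ξ => by
      rw [inner_dagger hD T ⟨star B (η : H), hB η η.2⟩ ξ]
      exact B.adjoint_inner_left _ _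
  refine ⟨fun ξ => ((B.continuous.tendsto _).comp (h.1 ξ)), fun η => ?_⟩
  have := h.2 ⟨star B (η : H), hB η η.2⟩
  simpa [hr, hm, star_mul] using this

/-- `T` is invertible over `M` and `T⁻¹ ∈ S`: there is `B ∈ S ∩ M` with `T B = I = B T` on `D`. -/
def HasInverseIn (hD : Dense (D : Set H)) (M : VonNeumannAlgebra H)
    (hM : LeavesInvariant (M : Set (H →L[ℂ] H)) D) (T : LDagger D) (S : Set (H →L[ℂ] H)) : Prop :=
  ∃ (B : H →L[ℂ] H) (hB : B ∈ M), B ∈ S ∧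
    mulBounded hD T B (hM B hB) = restrict D 1 ∧
    boundedMul hD B (hM (star B) (star_mem hB)) T = restrict D 1

/-- The operator `T` is positive and self-adjoint. -/
def IsPositiveSelfAdjoint (T : H →ₗ.[ℂ] H) : Prop :=
  IsSelfAdjoint T ∧ ∀ ξ : T.domain, 0 ≤ (inner ℂ (ξ : H) (T ξ) : ℂ).re

end

end UnboundedOp

/-! All three conditions are compared through bounded resolvents, handled as graph statements. (i) ⇒
(ii): the contractions `R i = (1 + X i)⁻¹` commute with every `X j`, so `R i - R j = R i R j (X j -
X i)`. Hence `R i ξ` is Cauchy whenever `X i ξ` is, and the `R i` converge strongly to the inverse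
`B` of `1 + A` (`IsCommQuasiPositive.exists_inverse`). (ii) ⇒ (iii): the inverse determines the
closure, whose graph is `{q | B (q.1 + q.2) = q.1}`. Symmetry of `B` makes it self-adjoint, and `B²
≤ B` makes it positive (`isPositiveSelfAdjoint_closure_of_inverse`). (iii) ⇒ (i): the closure is
affiliated with the von Neumann algebra, so its Yosida approximants form a commuting positive
sequence there, converging to `A` (`isCommQuasiPositive_of_isPositiveSelfAdjoint`). -/

namespace UnboundedOp

variable {H : Type u} [NormedAddCommGroup H] [InnerProductSpace ℂ H]

/-- `R` is the resolvent `(c + T)⁻¹` of `T`. -/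
structure IsResolvent (T : H →ₗ.[ℂ] H) (c : ℝ) (R : H →L[ℂ] H) : Prop where
  mem_graph : ∀ x, (R x, x - (c : ℂ) • R x) ∈ T.graph
  left_inv : ∀ p ∈ T.graph, R ((c : ℂ) • p.1 + p.2) = p.1

theorem IsResolvent.commute {T : H →ₗ.[ℂ] H} {c : ℝ} {R C : H →L[ℂ] H} (hR : IsResolvent T c R)
    (hC : ∀ p ∈ T.graph, (C p.1, C p.2) ∈ T.graph) : C * R = R * C := by
  ext x
  have h := hR.left_inv _ (hC _ (hR.mem_graph x))
  simp only [map_sub, map_smul, add_sub_cancel] at h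
  exact h.symm

theorem IsResolvent.map_mem_graph {T : H →ₗ.[ℂ] H} {c : ℝ} {R : H →L[ℂ] H}
    (hR : IsResolvent T c R) : ∀ p ∈ T.graph, (R p.1, R p.2) ∈ T.graph := by
  intro p hp
  have h := hR.left_inv p hp
  have h2 := hR.mem_graph p.1
  have h3 : R p.2 = p.1 - (c : ℂ) • R p.1 := by
    rw [map_add, map_smul] at h
    exact eq_sub_of_add_eq' h
  rwa [h3]

/-- The linear map `(ξ, T ξ) ↦ c ξ + T ξ` on the graph of `T`. -/
def graphShift (T : H →ₗ.[ℂ] H) (c : ℝ) : T.graph →ₗ[ℂ] H :=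
  ((c : ℂ) • LinearMap.fst ℂ H H + LinearMap.snd ℂ H H).comp T.graph.subtype

theorem graphShift_apply (T : H →ₗ.[ℂ] H) (c : ℝ) (p : T.graph) :
    graphShift T c p = (c : ℂ) • p.1.1 + p.1.2 := rfl

theorem isPositive_of_inner {R : H →L[ℂ] H}
    (h1 : ∀ x y, inner ℂ (R x) y = inner ℂ x (R y)) (h2 : ∀ x, 0 ≤ (inner ℂ (R x) x : ℂ).re) :
    R.IsPositive :=
  (ContinuousLinearMap.isPositive_iff_complex R).2 fun x => by
    refine ⟨?_, h2 x⟩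
    have : (starRingEnd ℂ) (inner ℂ (R x) x) = inner ℂ (R x) x := by
      rw [inner_conj_symm, h1]
    exact Complex.conj_eq_iff_re.1 this

theorem mem_graph_toPMap {X : H →L[ℂ] H} {p : H × H} :
    p ∈ (X.toLinearMap.toPMap ⊤).graph ↔ X p.1 = p.2 := by
  rw [LinearPMap.mem_graph_iff]
  constructor
  · rintro ⟨y, h1, h2⟩
    rw [← h1, ← h2]; rfl
  · exact fun h => ⟨⟨p.1, trivial⟩, rfl, h⟩

variable [CompleteSpace H]

/-! ### Existence of resolvents of positive self-adjoint operators. -/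

theorem IsPositiveSelfAdjoint.inner_comm {T : H →ₗ.[ℂ] H} (hT : IsPositiveSelfAdjoint T)
    {p q : H × H} (hp : p ∈ T.graph) (hq : q ∈ T.graph) :
    inner ℂ p.2 q.1 = inner ℂ p.1 q.2 := by
  have h := hT.1
  rw [LinearPMap.isSelfAdjoint_def] at h
  rw [← h, LinearPMap.adjoint_graph_eq_graph_adjoint hT.1.dense_domain,
    Submodule.mem_adjoint_iff] at hq
  exact sub_eq_zero.1 (hq p.1 p.2 hp)

theorem IsPositiveSelfAdjoint.re_inner_nonneg {T : H →ₗ.[ℂ] H} (hT : IsPositiveSelfAdjoint T)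
    {p : H × H} (hp : p ∈ T.graph) : 0 ≤ (inner ℂ p.1 p.2 : ℂ).re := by
  obtain ⟨ξ, h1, h2⟩ := (LinearPMap.mem_graph_iff T).1 hp
  rw [← h1, ← h2]
  exact hT.2 ξ

theorem IsPositiveSelfAdjoint.mem_graph {T : H →ₗ.[ℂ] H} (hT : IsPositiveSelfAdjoint T)
    {q : H × H} (hq : ∀ p ∈ T.graph, inner ℂ p.2 q.1 = inner ℂ p.1 q.2) : q ∈ T.graph := by
  have h := hT.1
  rw [LinearPMap.isSelfAdjoint_def] at h
  rw [← h, LinearPMap.adjoint_graph_eq_graph_adjoint hT.1.dense_domain,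
    Submodule.mem_adjoint_iff]
  exact fun a b hab => sub_eq_zero.2 (hq (a, b) hab)

/-- Cauchy–Schwarz: by positivity, pairing with `p.1` gives a real part of at least `c ‖p.1‖²`. -/
theorem IsPositiveSelfAdjoint.norm_le {T : H →ₗ.[ℂ] H} (hT : IsPositiveSelfAdjoint T)
    {c : ℝ} {p : H × H} (hp : p ∈ T.graph) :
    c * ‖p.1‖ ≤ ‖(c : ℂ) • p.1 + p.2‖ := by
  rcases eq_or_ne p.1 0 with h0 | h0
  · simp [h0]
  have h1 := re_inner_le_norm (𝕜 := ℂ) p.1 ((c : ℂ) • p.1 + p.2)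
  have h2 := hT.re_inner_nonneg hp
  have h3 : (inner ℂ p.1 ((c : ℂ) • p.1 + p.2) : ℂ).re =
      c * ‖p.1‖ ^ 2 + (inner ℂ p.1 p.2 : ℂ).re := by
    rw [inner_add_right, inner_smul_right, Complex.add_re, Complex.re_ofReal_mul,
      inner_self_eq_norm_sq_to_K]
    norm_cast
  change (inner ℂ p.1 ((c : ℂ) • p.1 + p.2) : ℂ).re ≤ _ at h1
  rw [h3] at h1
  have h4 : 0 < ‖p.1‖ := norm_pos_iff.2 h0
  refine le_of_mul_le_mul_left ?_ h4
  nlinarith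

theorem IsPositiveSelfAdjoint.isClosed_range_graphShift {T : H →ₗ.[ℂ] H}
    (hT : IsPositiveSelfAdjoint T) {c : ℝ} (hc : 0 < c) :
    IsClosed ((graphShift T c).range : Set H) := by
  have hcl : IsClosed (T.graph : Set (H × H)) := hT.1.isClosed
  have := hcl.completeSpace_coe
  -- With `y` the image of `p`, `‖p.1‖ ≤ c⁻¹ ‖y‖` and `‖p.2‖ ≤ 2 ‖y‖`; the constant dominates both.
  have hanti : AntilipschitzWith (Real.toNNReal (c⁻¹ + 2)) (graphShift T c) := by
    refine AddMonoidHomClass.antilipschitz_of_bound _ fun p => ?_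
    rw [Real.coe_toNNReal _ (by positivity), graphShift_apply]
    have h1 := hT.norm_le (c := c) p.2
    set y := (c : ℂ) • p.1.1 + p.1.2 with hy
    have h2 : ‖p.1.1‖ ≤ c⁻¹ * ‖y‖ := by
      rw [inv_mul_eq_div, le_div_iff₀ hc]; linarith
    have h3 : ‖p.1.2‖ ≤ ‖y‖ + c * ‖p.1.1‖ := by
      have : p.1.2 = y - (c : ℂ) • p.1.1 := by rw [hy]; abel
      rw [this]
      refine (norm_sub_le _ _).trans ?_
      rw [norm_smul, Complex.norm_real, Real.norm_of_nonneg hc.le]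
    have h4 : 0 ≤ c⁻¹ * ‖y‖ := by positivity
    change max ‖p.1.1‖ ‖p.1.2‖ ≤ _
    refine max_le ?_ ?_ <;> nlinarith [norm_nonneg y]
  have hcont : UniformContinuous (graphShift T c) := by
    let L : T.graph →L[ℂ] H := ⟨graphShift T c, by
      change Continuous fun p : T.graph => (c : ℂ) • p.1.1 + p.1.2
      fun_prop⟩
    exact L.uniformContinuous
  exact hanti.isClosed_range hcont

/-- The range is closed, and a vector `y` orthogonal to it satisfies `T y = -c y`, which positivity
allows only for `y = 0`. -/
theorem IsPositiveSelfAdjoint.range_graphShift {T : H →ₗ.[ℂ] H}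
    (hT : IsPositiveSelfAdjoint T) {c : ℝ} (hc : 0 < c) : (graphShift T c).range = ⊤ := by
  have := (hT.isClosed_range_graphShift hc).completeSpace_coe
  rw [← Submodule.orthogonal_eq_bot_iff, Submodule.eq_bot_iff]
  intro y hy
  rw [Submodule.mem_orthogonal] at hy
  have hmem : (y, -(c : ℂ) • y) ∈ T.graph := hT.mem_graph fun p hp => by
    have h := hy _ ⟨⟨p, hp⟩, rfl⟩
    rw [graphShift_apply, inner_add_left, inner_smul_left, Complex.conj_ofReal] at h
    rw [inner_smul_right]
    linear_combination h
  have h := hT.re_inner_nonneg hmem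
  dsimp only at h
  rw [inner_smul_right, inner_self_eq_norm_sq_to_K, ← Complex.ofReal_neg, Complex.re_ofReal_mul]
    at h
  have h' : 0 ≤ -c * ‖y‖ ^ 2 := by exact_mod_cast h
  have : ‖y‖ ^ 2 ≤ 0 := by nlinarith
  exact norm_eq_zero.1 (pow_eq_zero_iff two_ne_zero |>.1 (le_antisymm this (sq_nonneg _)))

theorem IsPositiveSelfAdjoint.exists_isResolvent {T : H →ₗ.[ℂ] H}
    (hT : IsPositiveSelfAdjoint T) {c : ℝ} (hc : 0 < c) :
    ∃ R : H →L[ℂ] H, IsResolvent T c R := by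
  have hinj : Function.Injective (graphShift T c) := by
    rw [← LinearMap.ker_eq_bot, LinearMap.ker_eq_bot']
    intro p hp
    have h := hT.norm_le (c := c) p.2
    rw [← graphShift_apply, hp, norm_zero] at h
    have h1 : p.1.1 = 0 := by
      rw [← norm_eq_zero]
      exact le_antisymm (nonpos_of_mul_nonpos_right h hc) (norm_nonneg _)
    rw [graphShift_apply, h1, smul_zero, zero_add] at hp
    exact Subtype.ext (Prod.ext h1 hp)
  let e := LinearEquiv.ofBijective (graphShift T c)
    ⟨hinj, LinearMap.range_eq_top.1 (hT.range_graphShift hc)⟩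
  have he : ∀ x, x = (c : ℂ) • (e.symm x).1.1 + (e.symm x).1.2 := fun x =>
    (e.apply_symm_apply x).symm
  let R : H →L[ℂ] H := ((LinearMap.fst ℂ H H).comp (T.graph.subtype.comp
    e.symm.toLinearMap)).mkContinuous c⁻¹ fun x => by
      rw [inv_mul_eq_div, le_div_iff₀ hc, mul_comm]
      conv_rhs => rw [he x]
      exact hT.norm_le (e.symm x).2
  have hRx : ∀ x, R x = (e.symm x).1.1 := fun x => rfl
  refine ⟨R, fun x => ?_, fun p hp => ?_⟩
  · have : (R x, x - (c : ℂ) • R x) = (e.symm x).1 := by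
      refine Prod.ext rfl ?_
      change x - (c : ℂ) • R x = _
      rw [sub_eq_iff_eq_add', hRx]
      exact he x
    rw [this]
    exact (e.symm x).2
  · rw [hRx]
    have : e.symm ((c : ℂ) • p.1 + p.2) = ⟨p, hp⟩ := e.symm_apply_apply ⟨p, hp⟩
    rw [this]

/-! ### Positivity of resolvents and membership in the algebra. -/

theorem IsResolvent.norm_apply_le {T : H →ₗ.[ℂ] H} (hT : IsPositiveSelfAdjoint T) {c : ℝ}
    {R : H →L[ℂ] H} (hR : IsResolvent T c R) (x : H) : c * ‖R x‖ ≤ ‖x‖ := by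
  simpa using hT.norm_le (c := c) (hR.mem_graph x)

theorem IsResolvent.inner_comm {T : H →ₗ.[ℂ] H} (hT : IsPositiveSelfAdjoint T) {c : ℝ}
    {R : H →L[ℂ] H} (hR : IsResolvent T c R) (x y : H) :
    inner ℂ (R x) y = inner ℂ x (R y) := by
  have h := hT.inner_comm (hR.mem_graph x) (hR.mem_graph y)
  simp only [inner_sub_left, inner_sub_right, inner_smul_left, inner_smul_right,
    Complex.conj_ofReal] at h
  linear_combination -h

theorem IsResolvent.isPositive {T : H →ₗ.[ℂ] H} (hT : IsPositiveSelfAdjoint T) {c : ℝ}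
    (hc : 0 < c) {R : H →L[ℂ] H} (hR : IsResolvent T c R) : R.IsPositive := by
  refine isPositive_of_inner (hR.inner_comm hT) fun x => ?_
  have h := hT.re_inner_nonneg (hR.mem_graph x)
  simp only [inner_sub_right, inner_smul_right, Complex.sub_re, Complex.re_ofReal_mul,
    inner_self_eq_norm_sq_to_K] at h
  have h' : 0 ≤ (inner ℂ (R x) x : ℂ).re - c * ‖R x‖ ^ 2 := by exact_mod_cast h
  nlinarith [sq_nonneg ‖R x‖, mul_nonneg hc.le (sq_nonneg ‖R x‖)]

/-- The Yosida approximation `c (1 - c (c + T)⁻¹)` is positive. -/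
theorem IsResolvent.isPositive_yosida {T : H →ₗ.[ℂ] H} (hT : IsPositiveSelfAdjoint T) {c : ℝ}
    (hc : 0 < c) {R : H →L[ℂ] H} (hR : IsResolvent T c R) :
    ((c : ℂ) • (1 - (c : ℂ) • R)).IsPositive := by
  refine ContinuousLinearMap.IsPositive.smul_of_nonneg
    (isPositive_of_inner (fun x y => ?_) fun x => ?_) (by exact_mod_cast hc.le)
  · simp [hR.inner_comm hT]
  · have h := hT.re_inner_nonneg (hR.mem_graph x)
    dsimp only at h
    -- Here `z = T R x`, so `⟨z, x⟩ = ‖z‖² + c ⟨z, R x⟩`, and the last term has nonnegative real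
    -- part.
    set z := x - (c : ℂ) • R x with hz
    have hx : x = z + (c : ℂ) • R x := by rw [hz]; abel
    change 0 ≤ (inner ℂ z x : ℂ).re
    rw [hx, inner_add_right, inner_smul_right, Complex.add_re, Complex.re_ofReal_mul,
      inner_self_eq_norm_sq_to_K, ← inner_conj_symm, Complex.conj_re]
    have : (((‖z‖ : ℝ) : ℂ) ^ 2).re = ‖z‖ ^ 2 := by norm_cast
    change 0 ≤ (((‖z‖ : ℝ) : ℂ) ^ 2).re + _
    rw [this]
    positivity

theorem IsResolvent.mem {M : VonNeumannAlgebra H} {T : H →ₗ.[ℂ] H} {c : ℝ} {R : H →L[ℂ] H}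
    (hR : IsResolvent T c R)
    (hT : ∀ C ∈ M.commutant, ∀ p ∈ T.graph, (C p.1, C p.2) ∈ T.graph) : R ∈ M := by
  rw [← M.commutant_commutant, VonNeumannAlgebra.mem_commutant_iff]
  exact fun C hC => hR.commute (hT C hC)

theorem isPositiveSelfAdjoint_toPMap {X : H →L[ℂ] H} (hX : X.IsPositive) :
    IsPositiveSelfAdjoint (X.toLinearMap.toPMap ⊤) := by
  refine ⟨?_, fun ξ => hX.re_inner_nonneg_right ξ⟩
  rw [LinearPMap.isSelfAdjoint_def, X.toPMap_adjoint_eq_adjoint_toPMap_of_dense (by simp),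
    hX.isSelfAdjoint.adjoint_eq]

variable {D : Submodule ℂ H}

theorem dagger_restrict (hD : Dense (D : Set H)) (X : H →L[ℂ] H) (η : D) :
    dagger (restrict D X) η = star X (η : H) :=
  dagger_eq hD _ _ _ fun _ => X.adjoint_inner_left _ _

/-! ### Elements of the completion, their closures and affiliation. -/

theorem continuous_eval (ξ : D) : Continuous fun Z : LDagger D => Z.1 ξ :=
  continuous_iff_continuousAt.2 fun _ => (tendsto_strongStar.1 tendsto_id).1 ξ

theorem continuous_dagger (ξ : D) : Continuous fun Z : LDagger D => dagger Z ξ :=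
  continuous_iff_continuousAt.2 fun _ => (tendsto_strongStar.1 tendsto_id).2 ξ

/-- A weak form of commutation with the commutant, needed because `C` need not leave `D` invariant.
It holds on the algebra and is closed under strong* limits. -/
theorem inner_apply_of_mem_completion (hD : Dense (D : Set H)) {M : VonNeumannAlgebra H}
    {A : LDagger D} (hA : A ∈ completion M D) {C : H →L[ℂ] H} (hC : C ∈ M.commutant) (ξ η : D) :
    inner ℂ (dagger A η) (C ξ) = inner ℂ (η : H) (C (A.1 ξ)) := by
  have hcl : IsClosed {Z : LDagger D |
      inner ℂ (dagger Z η) (C ξ) = inner ℂ (η : H) (C (Z.1 ξ))} :=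
    isClosed_eq ((continuous_dagger η).inner continuous_const)
      (continuous_const.inner (C.continuous.comp (continuous_eval ξ)))
  refine closure_minimal ?_ hcl hA
  rintro _ ⟨X, hX, rfl⟩
  change inner ℂ (dagger (restrict D X) η) (C ξ) = inner ℂ (η : H) (C (X ξ))
  have h : X * C = C * X := VonNeumannAlgebra.mem_commutant_iff.1 hC X hX
  rw [dagger_restrict hD, ContinuousLinearMap.star_eq_adjoint,
    ContinuousLinearMap.adjoint_inner_left]
  exact congrArg _ (DFunLike.congr_fun h (ξ : H))

/-- The adjoint is densely defined, so `A` is contained in its closed second adjoint. -/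
theorem isClosable_toPMap (hD : Dense (D : Set H)) (A : LDagger D) : (toPMap A.1).IsClosable := by
  have hle : D ≤ (toPMap A.1).adjoint.domain := A.2
  have hd : Dense ((toPMap A.1).adjoint.domain : Set H) := hD.mono hle
  exact (LinearPMap.adjoint_isClosed hd).isClosable.leIsClosable
    (LinearPMap.IsFormalAdjoint.le_adjoint hd (LinearPMap.adjoint_isFormalAdjoint hD))

theorem coe_graph_closure (hD : Dense (D : Set H)) (A : LDagger D) :
    ((toPMap A.1).closure.graph : Set (H × H)) =
      closure (Set.range fun ξ : D => ((ξ : H), A.1 ξ)) := by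
  rw [← (isClosable_toPMap hD A).graph_closure_eq_closure_graph, Submodule.topologicalClosure_coe]
  congr 1
  ext p
  rw [SetLike.mem_coe, LinearPMap.mem_graph_iff]
  constructor
  · rintro ⟨y, h1, h2⟩; exact ⟨y, Prod.ext h1 h2⟩
  · rintro ⟨y, rfl⟩; exact ⟨y, rfl, rfl⟩

theorem mem_graph_closure (hD : Dense (D : Set H)) (A : LDagger D) (ξ : D) :
    ((ξ : H), A.1 ξ) ∈ (toPMap A.1).closure.graph := by
  rw [← SetLike.mem_coe, coe_graph_closure hD]
  exact subset_closure ⟨ξ, rfl⟩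

theorem graph_closure_induction (hD : Dense (D : Set H)) (A : LDagger D) {s : Set (H × H)}
    (hs : IsClosed s) (h : ∀ ξ : D, ((ξ : H), A.1 ξ) ∈ s) :
    ∀ p ∈ (toPMap A.1).closure.graph, p ∈ s := by
  intro p hp
  rw [← SetLike.mem_coe, coe_graph_closure hD] at hp
  exact closure_minimal (Set.range_subset_iff.2 h) hs hp

theorem dagger_eq_self (hD : Dense (D : Set H)) {A : LDagger D}
    (hA : IsPositiveSelfAdjoint (toPMap A.1).closure) (η : D) : dagger A η = A.1 η :=
  dagger_eq hD _ _ _ fun ξ =>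
    hA.inner_comm (mem_graph_closure hD A η) (mem_graph_closure hD A ξ)

/-- A self-adjoint closure of an element of the completion is affiliated with `M`. -/
theorem commutant_map_mem_graph (hD : Dense (D : Set H)) {M : VonNeumannAlgebra H}
    {A : LDagger D} (hA : A ∈ completion M D)
    (hs : IsPositiveSelfAdjoint (toPMap A.1).closure) {C : H →L[ℂ] H} (hC : C ∈ M.commutant) :
    ∀ p ∈ (toPMap A.1).closure.graph, (C p.1, C p.2) ∈ (toPMap A.1).closure.graph := by
  intro p hp
  -- Self-adjointness turns membership into a pairing identity, closed in both graph points, so both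
  -- may be taken over `D`.
  refine hs.mem_graph fun q hq => ?_
  refine graph_closure_induction hD A
    (s := {q | inner ℂ q.2 (C p.1) = inner ℂ q.1 (C p.2)})
    (isClosed_eq (by fun_prop) (by fun_prop)) (fun η => ?_) q hq
  refine graph_closure_induction hD A
    (s := {p | inner ℂ (A.1 η) (C p.1) = inner ℂ (η : H) (C p.2)})
    (isClosed_eq (by fun_prop) (by fun_prop)) (fun ξ => ?_) p hp
  have h := inner_apply_of_mem_completion hD hA hC ξ η
  rwa [dagger_eq_self hD hs] at h

/-! ### From a bounded inverse to a positive self-adjoint closure. -/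

theorem hasInverseIn_iff (hD : Dense (D : Set H)) (M : VonNeumannAlgebra H)
    (hM : LeavesInvariant (M : Set (H →L[ℂ] H)) D) (A : LDagger D) :
    HasInverseIn hD M hM (restrict D 1 + A) (positiveUnitBall M) ↔
      ∃ B ∈ M, B.IsPositive ∧ ‖B‖ ≤ 1 ∧
        (∀ ξ : D, ∃ h : B ξ ∈ D, B ξ + A.1 ⟨B ξ, h⟩ = ξ) ∧
        ∀ ξ : D, B (ξ + A.1 ξ) = ξ := by
  constructor
  · rintro ⟨B, hB, hB', h1, h2⟩
    refine ⟨B, hB, hB'.2.1, hB'.2.2, fun ξ => ⟨hM B hB ξ ξ.2, ?_⟩, fun ξ => ?_⟩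
    · exact LinearMap.congr_fun (congrArg Subtype.val h1) ξ
    · exact LinearMap.congr_fun (congrArg Subtype.val h2) ξ
  · rintro ⟨B, hB, hp, hn, h1, h2⟩
    refine ⟨B, hB, ⟨hB, hp, hn⟩, ?_, ?_⟩
    · exact Subtype.ext (LinearMap.ext fun ξ => (h1 ξ).2)
    · exact Subtype.ext (LinearMap.ext fun ξ => h2 ξ)

/-- For `x` in `D` the pair `(B x, x - B x)` lies in the graph of `A`; by density its closure
contains these pairs for all `x`, in particular for `x = q.1 + q.2`. -/
theorem mem_graph_closure_iff_of_inverse (hD : Dense (D : Set H)) {A : LDagger D} {B : H →L[ℂ] H}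
    (h1 : ∀ ξ : D, ∃ h : B ξ ∈ D, B ξ + A.1 ⟨B ξ, h⟩ = ξ)
    (h2 : ∀ ξ : D, B (ξ + A.1 ξ) = ξ) (q : H × H) :
    q ∈ (toPMap A.1).closure.graph ↔ B (q.1 + q.2) = q.1 := by
  constructor
  · exact graph_closure_induction hD A (s := {q | B (q.1 + q.2) = q.1})
      (isClosed_eq (by fun_prop) (by fun_prop)) h2 q
  · intro hq
    have hcl : IsClosed {x : H | (B x, x - B x) ∈ ((toPMap A.1).closure.graph : Set (H × H))} :=
      (isClosable_toPMap hD A).closure_isClosed.preimage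
        (f := fun x : H => (B x, x - B x)) (by fun_prop)
    have hsub : (D : Set H) ⊆
        {x : H | (B x, x - B x) ∈ ((toPMap A.1).closure.graph : Set (H × H))} := by
      intro ξ hξ
      obtain ⟨h, h'⟩ := h1 ⟨ξ, hξ⟩
      have := mem_graph_closure hD A ⟨B ξ, h⟩
      rwa [eq_sub_of_add_eq' h'] at this
    have := hcl.closure_subset_iff.2 hsub (hD (q.1 + q.2))
    have e : (B (q.1 + q.2), q.1 + q.2 - B (q.1 + q.2)) = q := by
      rw [hq, add_sub_cancel_left]
    rw [← e]
    exact this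

/-- This is `B² ≤ B`, valid since `0 ≤ B ≤ 1`. -/
theorem norm_apply_sq_le_of_isPositive {B : H →L[ℂ] H} (hp : B.IsPositive) (hn : ‖B‖ ≤ 1) (x : H) :
    ‖B x‖ ^ 2 ≤ (inner ℂ (B x) x : ℂ).re := by
  have h0 : 0 ≤ B := (ContinuousLinearMap.nonneg_iff_isPositive B).2 hp
  have h : B ^ 2 ≤ B ^ 1 := CStarAlgebra.pow_antitone h0
    ((CStarAlgebra.norm_le_one_iff_of_nonneg B h0).1 hn) one_le_two
  rw [ContinuousLinearMap.le_def, pow_one, pow_two] at h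
  have h2 := h.re_inner_nonneg_left x
  change 0 ≤ (inner ℂ (B x - B (B x)) x : ℂ).re at h2
  rw [inner_sub_left, hp.inner_left_eq_inner_right (B x), Complex.sub_re,
    inner_self_eq_norm_sq_to_K] at h2
  have e : (((‖B x‖ : ℝ) : ℂ) ^ 2).re = ‖B x‖ ^ 2 := by norm_cast
  change 0 ≤ _ - (((‖B x‖ : ℝ) : ℂ) ^ 2).re at h2
  linarith

theorem isPositiveSelfAdjoint_closure_of_inverse (hD : Dense (D : Set H)) {A : LDagger D}
    {B : H →L[ℂ] H} (hp : B.IsPositive) (hn : ‖B‖ ≤ 1)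
    (h1 : ∀ ξ : D, ∃ h : B ξ ∈ D, B ξ + A.1 ⟨B ξ, h⟩ = ξ)
    (h2 : ∀ ξ : D, B (ξ + A.1 ξ) = ξ) :
    IsPositiveSelfAdjoint (toPMap A.1).closure := by
  have hg := mem_graph_closure_iff_of_inverse hD h1 h2
  have hdense : Dense ((toPMap A.1).closure.domain : Set H) :=
    hD.mono ((toPMap A.1).le_closure.1)
  have hsymm := hp.inner_left_eq_inner_right
  refine ⟨?_, fun ξ => ?_⟩
  · rw [LinearPMap.isSelfAdjoint_def]
    refine LinearPMap.eq_of_eq_graph (Submodule.ext fun q => ?_)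
    rw [LinearPMap.adjoint_graph_eq_graph_adjoint hdense, Submodule.mem_adjoint_iff, hg]
    constructor
    · intro h
      refine ext_inner_left ℂ fun z => ?_
      -- The graph is parametrized by `z ↦ (B z, z - B z)`; testing against all `z` recovers the
      -- equation for `q`.
      have hz := h (B z) (z - B z) ((hg _).2 (by rw [add_sub_cancel]))
      rw [inner_sub_left, hsymm, hsymm] at hz
      rw [map_add, inner_add_right]
      linear_combination -hz
    · intro h a b hab
      have hab' := (hg _).1 hab
      dsimp only at hab'
      have e1 : inner ℂ (a + b) (B (q.1 + q.2)) = inner ℂ (B (a + b)) (q.1 + q.2) :=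
        (hsymm _ _).symm
      rw [h, hab', inner_add_left, inner_add_right] at e1
      linear_combination e1
  · have h := (hg _).1 ((toPMap A.1).closure.mem_graph ξ)
    dsimp only at h
    -- Since `B (ξ + T ξ) = ξ`, this reads `‖ξ‖² ≤ ‖ξ‖² + Re ⟨ξ, T ξ⟩`.
    have h3 := norm_apply_sq_le_of_isPositive hp hn ((ξ : H) + (toPMap A.1).closure ξ)
    rw [h, inner_add_right, Complex.add_re, inner_self_eq_norm_sq_to_K] at h3
    have : (((‖(ξ : H)‖ : ℝ) : ℂ) ^ 2).re = ‖(ξ : H)‖ ^ 2 := by norm_cast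
    change _ ≤ (((‖(ξ : H)‖ : ℝ) : ℂ) ^ 2).re + _ at h3
    linarith

/-! ### Yosida approximation. -/

/-- `c (c + T)⁻¹` tends strongly to the identity as `c → ∞`. -/
theorem tendsto_smul_resolvent {T : H →ₗ.[ℂ] H} (hT : IsPositiveSelfAdjoint T)
    {R : ℕ → H →L[ℂ] H} (hR : ∀ n : ℕ, IsResolvent T (n + 1 : ℝ) (R n)) (x : H) :
    Tendsto (fun n : ℕ => ((n + 1 : ℝ) : ℂ) • R n x) atTop (𝓝 x) := by
  have hpos : ∀ n : ℕ, (0 : ℝ) < n + 1 := fun n => by positivity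
  have hnorm : ∀ (n : ℕ) (x : H), ‖((n + 1 : ℝ) : ℂ) • R n x‖ ≤ ‖x‖ := fun n x => by
    rw [norm_smul, Complex.norm_real, Real.norm_of_nonneg (hpos n).le]
    exact (hR n).norm_apply_le hT x
  -- Equicontinuity reduces the limit to the dense domain, where the error is `-R n (T ξ)`, of norm
  -- at most `‖T ξ‖ / (n + 1)`.
  have hequi : Equicontinuous fun (n : ℕ) (x : H) => ((n + 1 : ℝ) : ℂ) • R n x := by
    refine (LipschitzWith.uniformEquicontinuous _ 1 fun n => ?_).equicontinuous
    refine LipschitzWith.of_dist_le_mul fun x y => ?_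
    rw [dist_eq_norm, dist_eq_norm, ← smul_sub, ← map_sub, NNReal.coe_one, one_mul]
    exact hnorm n _
  have hcl := hequi.isClosed_setOfPred_tendsto (l := atTop) (f := id) continuous_id
  have hsub : (T.domain : Set H) ⊆ {x | Tendsto (fun n : ℕ => ((n + 1 : ℝ) : ℂ) • R n x) atTop
      (𝓝 (id x))} := by
    intro ξ hξ
    rw [Set.mem_ofPred_eq, tendsto_iff_norm_sub_tendsto_zero]
    have hlim : Tendsto (fun n : ℕ => 1 / ((n : ℝ) + 1) * ‖T ⟨ξ, hξ⟩‖) atTop (𝓝 0) := by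
      simpa using tendsto_one_div_add_atTop_nhds_zero_nat.mul_const ‖T ⟨ξ, hξ⟩‖
    refine squeeze_zero (fun _ => norm_nonneg _) (fun n => ?_) hlim
    have h := (hR n).left_inv _ (T.mem_graph ⟨ξ, hξ⟩)
    dsimp only at h
    rw [map_add, map_smul] at h
    have e : ((n + 1 : ℝ) : ℂ) • R n ξ - ξ = -R n (T ⟨ξ, hξ⟩) := by
      rw [eq_sub_of_add_eq h]
      abel
    rw [id, e, norm_neg, one_div, inv_mul_eq_div, le_div_iff₀ (hpos n), mul_comm]
    exact (hR n).norm_apply_le hT (T ⟨ξ, hξ⟩)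
  exact hcl.closure_subset_iff.2 hsub (hT.1.dense_domain x)

theorem isCommQuasiPositive_of_isPositiveSelfAdjoint (hD : Dense (D : Set H))
    {M : VonNeumannAlgebra H} {A : LDagger D} (hA : A ∈ completion M D)
    (hs : IsPositiveSelfAdjoint (toPMap A.1).closure) : IsCommQuasiPositive M A := by
  have hpos : ∀ n : ℕ, (0 : ℝ) < n + 1 := fun n => by positivity
  choose R hR using fun n : ℕ => hs.exists_isResolvent (hpos n)
  set Y : ℕ → H →L[ℂ] H := fun n => ((n + 1 : ℝ) : ℂ) • (1 - ((n + 1 : ℝ) : ℂ) • R n) with hY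
  have hRM : ∀ n, R n ∈ M := fun n =>
    (hR n).mem fun C hC => commutant_map_mem_graph hD hA hs hC
  have hcomm : ∀ m n, Commute (R m) (R n) := fun m n => (hR n).commute (hR m).map_mem_graph
  have hYpos : ∀ n, (Y n).IsPositive := fun n => (hR n).isPositive_yosida hs (hpos n)
  have hYlim : ∀ ξ : D, Tendsto (fun n => Y n ξ) atTop (𝓝 (A.1 ξ)) := fun ξ => by
    -- On `D`, `c (1 - c R) ξ = c R (A ξ)`.
    refine (tendsto_smul_resolvent hs hR (A.1 ξ)).congr fun n => ?_
    have h := (hR n).left_inv _ (mem_graph_closure hD A ξ)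
    dsimp only at h
    rw [map_add, map_smul] at h
    change _ = ((n + 1 : ℝ) : ℂ) • ((ξ : H) - ((n + 1 : ℝ) : ℂ) • R n ξ)
    rw [← eq_sub_of_add_eq' h]
  have hlim : Tendsto (fun n => restrict D (Y n)) atTop (𝓝 A) := by
    refine tendsto_strongStar.2 ⟨hYlim, fun ξ => ?_⟩
    rw [dagger_eq_self hD hs]
    refine (hYlim ξ).congr fun n => ?_
    rw [dagger_restrict hD, (hYpos n).isSelfAdjoint.star_eq]
  -- The lift places the index set in the universe of `H`.
  refine ⟨ULift ℕ, inferInstance, inferInstance, inferInstance, fun i => Y i.down,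
    fun i => ⟨?_, hYpos _⟩, fun i j => ?_, ?_⟩
  · exact M.toStarSubalgebra.smul_mem
      (sub_mem (one_mem M) (M.toStarSubalgebra.smul_mem (hRM _) _)) _
  · exact ((((Commute.one_left _).sub_left
      (((Commute.one_right _).sub_right ((hcomm _ _).smul_right _)).smul_left _)).smul_left
        _).smul_right _)
  · exact hlim.comp (tendsto_atTop_atTop.2 fun n => ⟨⟨n⟩, fun _ h => h⟩)

/-! ### Strong limits of resolvents of a commuting net. -/

/-- The limit on `D` is a contraction, so it extends to `H`; equicontinuity carries the convergence
along. -/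
theorem exists_strong_limit {ι : Type*} {l : Filter ι} [l.NeBot] (hD : Dense (D : Set H))
    {R : ι → H →L[ℂ] H} (hn : ∀ i x, ‖R i x‖ ≤ ‖x‖)
    (hlim : ∀ ξ : D, ∃ y, Tendsto (fun i => R i ξ) l (𝓝 y)) :
    ∃ B : H →L[ℂ] H, ∀ x, Tendsto (fun i => R i x) l (𝓝 (B x)) := by
  choose f hf using hlim
  let F : D →ₗ[ℂ] H := linearMapOfTendsto f (fun i => (R i).toLinearMap.comp D.subtype)
    (tendsto_pi_nhds.2 hf)
  let F' : D →L[ℂ] H := F.mkContinuous 1 fun ξ => by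
    rw [one_mul]
    exact le_of_tendsto (hf ξ).norm (Eventually.of_forall fun i => hn i ξ)
  let B : H →L[ℂ] H := F'.extend D.subtypeL
  have hB : ∀ ξ : D, B ξ = f ξ := fun ξ =>
    F'.extend_eq (e := D.subtypeL) hD.denseRange_val
      isUniformEmbedding_subtype_val.isUniformInducing ξ
  refine ⟨B, fun x => ?_⟩
  have hequi : Equicontinuous fun (i : ι) (x : H) => R i x := by
    refine (LipschitzWith.uniformEquicontinuous _ 1 fun n => ?_).equicontinuous
    refine LipschitzWith.of_dist_le_mul fun x y => ?_
    rw [dist_eq_norm, dist_eq_norm, ← map_sub, NNReal.coe_one, one_mul]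
    exact hn n _
  have hcl := hequi.isClosed_setOfPred_tendsto (l := l) (f := B) B.continuous
  refine hcl.closure_subset_iff.2 ?_ (hD x)
  intro ξ hξ
  have := hf ⟨ξ, hξ⟩
  rwa [← hB] at this

theorem IsCommQuasiPositive.exists_inverse (hD : Dense (D : Set H)) {M : VonNeumannAlgebra H}
    (hM : LeavesInvariant (M : Set (H →L[ℂ] H)) D) {A : LDagger D}
    (hA : IsCommQuasiPositive M A) :
    ∃ B ∈ M, B.IsPositive ∧ ‖B‖ ≤ 1 ∧
      (∀ ξ : D, ∃ h : B ξ ∈ D, B ξ + A.1 ⟨B ξ, h⟩ = ξ) ∧ ∀ ξ : D, B (ξ + A.1 ξ) = ξ := by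
  obtain ⟨ι, _, _, _, X, hX, hcomm, hlim⟩ := hA
  have hXlim : ∀ ξ : D, Tendsto (fun i => X i ξ) atTop (𝓝 (A.1 ξ)) :=
    (tendsto_strongStar.1 hlim).1
  have hs := fun i => isPositiveSelfAdjoint_toPMap (hX i).2
  choose R hR using fun i => (hs i).exists_isResolvent one_pos
  have hgraph : ∀ {C : H →L[ℂ] H} {i}, C * X i = X i * C →
      ∀ p ∈ ((X i).toLinearMap.toPMap ⊤).graph,
        (C p.1, C p.2) ∈ ((X i).toLinearMap.toPMap ⊤).graph := by
    intro C i h p hp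
    rw [mem_graph_toPMap] at hp ⊢
    dsimp only
    rw [← hp]
    exact (DFunLike.congr_fun h p.1).symm
  have hRX : ∀ i j, R i * X j = X j * R i := fun i j => ((hR i).commute (hgraph (hcomm j i))).symm
  have hleft : ∀ i x, R i (x + X i x) = x := fun i x => by
    simpa using (hR i).left_inv (x, X i x) (mem_graph_toPMap.2 rfl)
  have hright : ∀ i x, R i x + X i (R i x) = x := fun i x => by
    have h : R i (X i x) = X i (R i x) := DFunLike.congr_fun (hRX i i) x
    rw [← h, ← map_add, hleft]
  have hn : ∀ i x, ‖R i x‖ ≤ ‖x‖ := fun i x => by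
    simpa using (hR i).norm_apply_le (hs i) x
  have hdist : ∀ i j x, ‖R i x - R j x‖ ≤ ‖X i x - X j x‖ := fun i j x => by
    -- The resolvent identity; commutativity puts `X j - X i` next to `x`, where convergence is
    -- known.
    have h : R i x - R j x = R i (R j (X j x - X i x)) := by
      have h1 : R j (X i x) = X i (R j x) := DFunLike.congr_fun (hRX j i) x
      have h2 : R j x = R i (R j x) + R i (X i (R j x)) := by rw [← map_add, hleft]
      have h3 : R i x = R i (R j x) + R i (R j (X j x)) := by rw [← map_add, ← map_add, hleft]
      rw [map_sub, map_sub, h1, h3]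
      nth_rw 2 [h2]
      abel
    rw [h, norm_sub_rev (X i x)]
    exact (hn _ _).trans (hn _ _)
  obtain ⟨B, hB⟩ := exists_strong_limit (l := atTop) hD hn fun ξ => by
    refine CompleteSpace.complete (cauchy_map_iff.2 ⟨inferInstance, ?_⟩)
    have h := (cauchy_map_iff.1 (hXlim ξ).cauchy_map).2
    rw [Metric.uniformity_eq_comap_nhds_zero, tendsto_comap_iff] at h ⊢
    refine squeeze_zero (fun _ => dist_nonneg) (fun p => ?_) h
    simp only [Function.comp_apply, dist_eq_norm]
    exact hdist _ _ _
  have hBM : B ∈ M := by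
    rw [← M.commutant_commutant, VonNeumannAlgebra.mem_commutant_iff]
    intro C hC
    have hRC : ∀ i, C * R i = R i * C := fun i =>
      (hR i).commute (hgraph (VonNeumannAlgebra.mem_commutant_iff.1 hC _ (hX i).1).symm)
    ext x
    refine tendsto_nhds_unique ((C.continuous.tendsto _).comp (hB x)) ((hB (C x)).congr fun i => ?_)
    exact (DFunLike.congr_fun (hRC i) x).symm
  have hBX : ∀ i x, B (X i x) = X i (B x) := fun i x => by
    refine tendsto_nhds_unique (hB (X i x))
      ((((X i).continuous.tendsto _).comp (hB x)).congr fun j => ?_)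
    exact (DFunLike.congr_fun (hRX j i) x).symm
  have hinv : ∀ ξ : D, B (ξ + A.1 ξ) = ξ := fun ξ => by
    have h1 : Tendsto (fun i => R i (ξ + A.1 ξ) - (ξ : H)) atTop (𝓝 0) := by
      refine squeeze_zero_norm (fun i => ?_) (tendsto_iff_norm_sub_tendsto_zero.1 (hXlim ξ))
      have : R i (ξ + A.1 ξ) - (ξ : H) = R i (A.1 ξ - X i ξ) := by
        nth_rw 2 [← hleft i ξ]
        rw [← map_sub, add_sub_add_left_eq_sub]
      rw [this, norm_sub_rev (X i ξ)]
      exact hn _ _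
    have h2 := (hB (ξ + A.1 ξ)).sub_const (ξ : H)
    exact sub_eq_zero.1 (tendsto_nhds_unique h2 h1)
  refine ⟨B, hBM, ?_, ?_, fun ξ => ⟨hM B hBM ξ ξ.2, ?_⟩, hinv⟩
  · refine isPositive_of_inner (fun x y => ?_) fun x => ?_
    · refine tendsto_nhds_unique ((hB x).inner tendsto_const_nhds)
        ((tendsto_const_nhds.inner (hB y)).congr fun i => ?_)
      exact ((hR i).inner_comm (hs i) x y).symm
    · refine ge_of_tendsto ((Complex.continuous_re.tendsto _).comp
        ((hB x).inner tendsto_const_nhds)) (Eventually.of_forall fun i => ?_)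
      exact ((hR i).isPositive (hs i) one_pos).re_inner_nonneg_left x
  · refine B.opNorm_le_bound zero_le_one fun x => ?_
    rw [one_mul]
    exact le_of_tendsto (hB x).norm (Eventually.of_forall fun i => hn i x)
  -- Invariance puts `B ξ` in `D`, so `X i (B ξ) = B (X i ξ)` tends both to `A (B ξ)` and to `B (A
  -- ξ)`; the right inverse follows from the left one.
  · have h1 : Tendsto (fun i => X i (B ξ)) atTop (𝓝 (B (A.1 ξ))) :=
      ((B.continuous.tendsto _).comp (hXlim ξ)).congr fun i => hBX i ξ
    have h2 := hXlim ⟨B ξ, hM B hBM ξ ξ.2⟩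
    rw [tendsto_nhds_unique h2 h1, ← map_add, hinv]

end UnboundedOp

open UnboundedOp in
theorem corollary4p4 {H : Type u} [NormedAddCommGroup H] [InnerProductSpace ℂ H] [CompleteSpace H]
    (D : Submodule ℂ H) (hD : Dense (D : Set H))
    (M₀ : StarSubalgebra ℂ (H →L[ℂ] H)) (hM₀ : IsClosed (M₀ : Set (H →L[ℂ] H)))
    (hM : LeavesInvariant (bicommutant M₀ : Set (H →L[ℂ] H)) D)
    (A : LDagger D) (hA : A ∈ completion (bicommutant M₀) D) :
    List.TFAE [
      IsCommQuasiPositive (bicommutant M₀) A,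
      HasInverseIn hD (bicommutant M₀) hM (restrict D 1 + A) (positiveUnitBall (bicommutant M₀)),
      IsPositiveSelfAdjoint (toPMap A.1).closure] := by
  rw [hasInverseIn_iff]
  tfae_have 1 → 2 := fun h => h.exists_inverse hD hM
  tfae_have 2 → 3 := by
    rintro ⟨B, -, hp, hn, h1, h2⟩
    exact isPositiveSelfAdjoint_closure_of_inverse hD hp hn h1 h2
  tfae_have 3 → 1 := isCommQuasiPositive_of_isPositiveSelfAdjoint hD hA
  tfae_finish
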